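/- Let $k$ be a field of characteristic $0$, $pt=\mathrm{Spec}\,k$, and let $\mathcal V$ be the category of quasi-projective $k$-schemes. **Bivariant side.** For a morphism $f:X\to Y$ in $\mathcal V$ let $\mathbb M(\mathcal V/X\xrightarrow{f}Y)$ be the free abelian group on isomorphism classes over $X$ of morphisms $h:W\to X$ with $W\in\mathcal V$, $h$ proper and $f\circ h$ smooth, where the class of a disjoint union is identified with the sum of the classes. It is graded by $\dim W$ ($W$ connected). A *double point cobordism relative to $f$* is a projective morphism $g=(p_1g,\pi):V\to X\times\mathbb P^1$ with $V\in\mathcal V$ and $[p_1g:V\to X]\in\mathbb M(\mathcal V/X\xrightarrow{f}Y)$, such that the scheme-theoretic fibre is $\pi^{-1}(0)=A\cup B$ for closed subschemes $A,B\subset V$ of codimension one, smooth over $Y$, meeting transversely over $Y$ (that is, $D=A\cap B$ is smooth over $Y$ and of codimension one in $A$ and in $B$), together with a point $\xi\in\mathbb P^1(k)$ that is a regular value of $\pi$ relative to $Y$ (that is, $(f p_1 g,\pi):V\to Y\times\mathbb P^1$ is smooth along $V_\xi=\pi^{-1}(\xi)$). Let $\mathbb P(\pi)=\mathbb P(\mathcal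 O_D\oplus N_{A/D})\to D$, where $N_{A/D}$ is the normal bundle of $D$ in $A$; the morphisms from $V_\xi$, $A$, $B$, $\mathbb P(\pi)$ to $Y$ are required to be smooth. The associated *double point relation* is $$[V_\xi\to X]-[A\to X]-[B\to X]+[\mathbb P(\pi)\to X].$$ Let $\mathcal R_*(X\xrightarrow{f}Y)$ be the subgroup generated by all these relations and put $$\mathbb{OB}3(X\xrightarrow{f}Y)=\mathbb M(\mathcal V/X\xrightarrow{f}Y)/\mathcal R_*(X\xrightarrow{f}Y).$$ **Double point bordism.** For $X\in\mathcal V$ let $\mathcal M_*(X)$ be the free abelian group on isomorphism classes over $X$ of projective morphisms $h:W\to X$ with $W$ smooth and quasi-projective over $k$, again with disjoint unions identified with sums, graded by $\dim W$. A *double point cobordism over $X$* is a projective morphism $g:V\to X\times\mathbb P^1$ with $V$ smooth and quasi-projective, such that $\pi=p_2g$ satisfies $\pi^{-1}(0)=A\cup B$ scheme-theoretically for smooth closed subschemes $A,B\subset V$ of codimension one that meet transversely, together with a regular value $\xi\in\mathbb P^1(k)$ of $\pi$. Let $\mathcal R_*(X)$ be the subgroup generated by the relations $[V_\xi\to X]-[A\to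 X]-[B\to X]+[\mathbb P(\pi)\to X]$, and let $\omega_*(X)=\mathcal M_*(X)/\mathcal R_*(X)$ be the Levine–Pandharipande double point bordism group. **Theorem.** For every quasi-projective $k$-scheme $X$, with structure morphism $c:X\to pt$, there is an isomorphism of graded abelian groups $$\mathbb{OB}3_*(X):=\mathbb{OB}3(X\xrightarrow{c}pt)\;\cong\;\omega_*(X)$$ which sends the class of each generator $[h:W\to X]$ to the class of $[h:W\to X]$ (so in particular each such $h$ is projective with $W$ smooth over $k$). -/

import Mathlib

open CategoryTheory CategoryTheory.Limits AlgebraicGeometry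

universe u

namespace DoublePoint

noncomputable section

/-! ### Projective space, projective and quasi-projective schemes over a field -/

/-- The category of schemes over the field `k`. -/
abbrev Sch (k : Type u) [Field k] : Type (u + 1) := Over (Spec (CommRingCat.of k))

/-- The point `pt = Spec k`. -/
def pt (k : Type u) [Field k] : Sch k := Over.mk (𝟙 _)

/-- The structure morphism `X ⟶ pt`. -/
def toPt {k : Type u} [Field k] (X : Sch k) : X ⟶ pt k :=
  Over.homMk X.hom (Category.comp_id _)

section ProjectiveSpace

attribute [local instance] MvPolynomial.gradedAlgebra

/-- Projective space `ℙⁿ = Proj k[X₀, …, Xₙ]` over `k`. -/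
def projectiveSpace (k : Type u) [Field k] (n : ℕ) : Sch k :=
  Over.mk (Proj.toSpecZero (MvPolynomial.homogeneousSubmodule (Fin (n + 1)) k) ≫
    Spec.map (CommRingCat.ofHom
      (algebraMap k (MvPolynomial.homogeneousSubmodule (Fin (n + 1)) k 0))))

/-- Evaluation at `(X₀, X₁) = (0, 1)` of the degree zero fractions `p / X₁ⁿ`. -/
def evalZeroOne (k : Type u) [Field k] :
    HomogeneousLocalization.Away (MvPolynomial.homogeneousSubmodule (Fin (1 + 1)) k)
      (MvPolynomial.X 1) →+* k :=
  (IsLocalization.Away.lift (S := Localization.Away (MvPolynomial.X (1 : Fin (1 + 1))))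
    (MvPolynomial.X (1 : Fin (1 + 1))) (g := MvPolynomial.eval (![0, 1] : Fin (1 + 1) → k))
    (by simp)).comp
    (algebraMap _ (Localization.Away (MvPolynomial.X (1 : Fin (1 + 1)) :
      MvPolynomial (Fin (1 + 1)) k)))

lemma evalZeroOne_fromZeroRingHom (k : Type u) [Field k] (x : k) :
    evalZeroOne k (HomogeneousLocalization.fromZeroRingHom
      (MvPolynomial.homogeneousSubmodule (Fin (1 + 1)) k) _ (algebraMap k _ x)) = x := by
  have h : algebraMap (HomogeneousLocalization.Away
      (MvPolynomial.homogeneousSubmodule (Fin (1 + 1)) k) (MvPolynomial.X 1))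
      (Localization.Away (MvPolynomial.X (1 : Fin (1 + 1)) : MvPolynomial (Fin (1 + 1)) k))
      (HomogeneousLocalization.fromZeroRingHom
        (MvPolynomial.homogeneousSubmodule (Fin (1 + 1)) k) _ (algebraMap k _ x)) =
      algebraMap (MvPolynomial (Fin (1 + 1)) k) _ (MvPolynomial.C x) :=
    Localization.mk_one_eq_algebraMap _
  rw [evalZeroOne, RingHom.comp_apply, h, IsLocalization.Away.lift_eq]
  simp

/-- The rational point `0 = [0 : 1]` of `ℙ¹`. -/
def zeroPoint (k : Type u) [Field k] : pt k ⟶ projectiveSpace k 1 :=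
  Over.homMk (Spec.map (CommRingCat.ofHom (evalZeroOne k)) ≫
    Proj.awayι (MvPolynomial.homogeneousSubmodule (Fin (1 + 1)) k) (MvPolynomial.X 1)
      ((MvPolynomial.mem_homogeneousSubmodule 1 _).2 (MvPolynomial.isHomogeneous_X k 1))
      one_pos) (by
    simp only [projectiveSpace, pt, Over.mk_hom, Category.assoc]
    rw [Proj.awayι_toSpecZero_assoc, ← Spec.map_comp, ← Spec.map_comp, ← Spec.map_id]
    congr 1
    ext x
    exact evalZeroOne_fromZeroRingHom k x)

end ProjectiveSpace

/-- The product `X × Y` of schemes over `k`. -/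
def prod {k : Type u} [Field k] (X Y : Sch k) : Sch k :=
  Over.mk (pullback.fst X.hom Y.hom ≫ X.hom)

/-- The first projection of `X × Y`. -/
def prodFst {k : Type u} [Field k] (X Y : Sch k) : prod X Y ⟶ X :=
  Over.homMk (pullback.fst X.hom Y.hom) rfl

/-- The second projection of `X × Y`. -/
def prodSnd {k : Type u} [Field k] (X Y : Sch k) : prod X Y ⟶ Y :=
  Over.homMk (pullback.snd X.hom Y.hom) pullback.condition.symm

/-- The morphism `(f, g) : V ⟶ X × Y`. -/
def prodLift {k : Type u} [Field k] {V X Y : Sch k} (f : V ⟶ X) (g : V ⟶ Y) : V ⟶ prod X Y :=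
  Over.homMk (pullback.lift f.left g.left ((Over.w f).trans (Over.w g).symm))
    ((pullback.lift_fst_assoc _ _ _ _).trans (Over.w f))

/-- A scheme over `k` is quasi-projective if it is a locally closed subscheme of some `ℙⁿ`. -/
def IsQuasiProjective {k : Type u} [Field k] (X : Sch k) : Prop :=
  ∃ (n : ℕ) (i : X ⟶ projectiveSpace k n), IsImmersion i.left

/-- A morphism `V ⟶ X` is projective if it factors as a closed immersion
`V ⟶ X × ℙⁿ` followed by the projection to `X`. -/
def IsProjective {k : Type u} [Field k] {V X : Sch k} (h : V ⟶ X) : Prop :=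
  ∃ (n : ℕ) (i : V ⟶ prod X (projectiveSpace k n)),
    IsClosedImmersion i.left ∧ i ≫ prodFst X (projectiveSpace k n) = h

/-! ### Cycle groups -/

/-- A condition on schemes `h : W ⟶ X` over `X`. -/
abbrev CycleCondition {k : Type u} [Field k] (X : Sch k) : Type (u + 1) :=
  ∀ W : Sch k, (W ⟶ X) → Prop

/-- A cycle `h : W ⟶ X` satisfying the condition `P`. -/
structure Cycle {k : Type u} [Field k] {X : Sch k} (P : CycleCondition X) : Type (u + 1) where
  W : Sch k
  h : W ⟶ X
  prop : P W h

/-- Cycles are equivalent if they are isomorphic over `X`. -/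
instance cycleSetoid {k : Type u} [Field k] {X : Sch k} (P : CycleCondition X) :
    Setoid (Cycle P) where
  r c c' := ∃ φ : c.W ≅ c'.W, φ.hom ≫ c'.h = c.h
  iseqv :=
    { refl := fun c => ⟨Iso.refl _, Category.id_comp _⟩
      symm := fun ⟨φ, hφ⟩ => ⟨φ.symm, by simp [← hφ]⟩
      trans := fun ⟨φ, hφ⟩ ⟨ψ, hψ⟩ => ⟨φ ≪≫ ψ, by simp [← hφ, ← hψ]⟩ }

/-- The cycle `c` is the disjoint union of the cycles `c₁` and `c₂`. -/
def IsDisjointUnion {k : Type u} [Field k] {X : Sch k} {P : CycleCondition X}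
    (c c₁ c₂ : Cycle P) : Prop :=
  ∃ (i₁ : c₁.W ⟶ c.W) (i₂ : c₂.W ⟶ c.W), i₁ ≫ c.h = c₁.h ∧ i₂ ≫ c.h = c₂.h ∧
    IsOpenImmersion i₁.left ∧ IsOpenImmersion i₂.left ∧
    IsCompl (Set.range i₁.left) (Set.range i₂.left)

/-- The free abelian group on isomorphism classes of cycles satisfying `P`, in which
disjoint unions are identified with sums (that is, the group completion under disjoint
union; equivalently, the free abelian group on the classes with `W` connected). -/
abbrev CycleGroup {k : Type u} [Field k] {X : Sch k} (P : CycleCondition X) : Type (u + 1) :=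
  FreeAbelianGroup (Quotient (cycleSetoid P)) ⧸ AddSubgroup.closure
    {r : FreeAbelianGroup (Quotient (cycleSetoid P)) |
      ∃ c c₁ c₂ : Cycle P, IsDisjointUnion c c₁ c₂ ∧
        r = FreeAbelianGroup.of ⟦c⟧ - FreeAbelianGroup.of ⟦c₁⟧ - FreeAbelianGroup.of ⟦c₂⟧}

/-- The class `[h : W ⟶ X]`. -/
def CycleGroup.cls {k : Type u} [Field k] {X : Sch k} {P : CycleCondition X} (c : Cycle P) :
    CycleGroup P :=
  QuotientAddGroup.mk (FreeAbelianGroup.of ⟦c⟧)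

/-- The degree `n` part, generated by the `[h : W ⟶ X]` with `W` connected of dimension `n`. -/
def CycleGroup.degree {k : Type u} [Field k] {X : Sch k} (P : CycleCondition X) (n : ℕ) :
    AddSubgroup (CycleGroup P) :=
  AddSubgroup.closure {r | ∃ c : Cycle P, ConnectedSpace c.W.left ∧
    topologicalKrullDim c.W.left = n ∧ r = CycleGroup.cls c}

/-- The condition for `𝓜_*(X)`: `W` is smooth (and quasi-projective), `h` is projective. -/
def IsSmoothProjectiveCycle {k : Type u} [Field k] (X : Sch k) : CycleCondition X :=
  fun W h => IsQuasiProjective W ∧ Smooth W.hom ∧ IsProjective h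

/-- The condition for `𝕄(𝒱/X ⟶ Y)`: `W` is quasi-projective, `h : W ⟶ X` is proper and
`f ∘ h : W ⟶ Y` is smooth. -/
def IsBivariantCycle {k : Type u} [Field k] {X Y : Sch k} (f : X ⟶ Y) : CycleCondition X :=
  fun W h => IsQuasiProjective W ∧ IsProper h.left ∧ Smooth (h ≫ f).left

/-! ### Conormal sheaves and projective bundles -/

/-- The structure sheaf as a module over itself. -/
def structureSheaf (X : Scheme.{u}) : X.Modules := SheafOfModules.unit X.ringCatSheaf

/-- The morphism `𝒪_A ⟶ i_* 𝒪_D` of a morphism `i : D ⟶ A`. -/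
def toPushforward {D A : Scheme.{u}} (i : D ⟶ A) :
    structureSheaf A ⟶ (Scheme.Modules.pushforward i).obj (structureSheaf D) :=
  SheafOfModules.unitToPushforwardObjUnit i.toRingCatSheafHom

/-- The conormal sheaf `i^* I = I / I²` of a closed immersion `i : D ⟶ A`, where `I` is the
ideal sheaf of `D`, the kernel of `𝒪_A ⟶ i_* 𝒪_D`. It is the dual of the normal bundle. -/
def conormalSheaf {D A : Scheme.{u}} (i : D ⟶ A) : D.Modules :=
  (Scheme.Modules.pullback i).obj (kernel (toPushforward i))

/-- A sheaf of modules is invertible if it is locally isomorphic to the structure sheaf. -/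
def IsInvertible {X : Scheme.{u}} (L : X.Modules) : Prop :=
  ∀ x : X, ∃ U : X.Opens, x ∈ U ∧
    Nonempty ((Scheme.Modules.pullback U.ι).obj L ≅ structureSheaf U)

/-- `p : P ⟶ D` is the projective bundle `Proj (Sym F) ⟶ D`, characterized by its functor of
points: morphisms from `t : T ⟶ D` to `P` over `D` correspond to isomorphism classes of
invertible quotients of `t^* F`. -/
def IsProjectiveBundle {P D : Scheme.{u}} (p : P ⟶ D) (F : D.Modules) : Prop :=
  ∃ (L : P.Modules) (q : (Scheme.Modules.pullback p).obj F ⟶ L), IsInvertible L ∧ Epi q ∧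
    ∀ (T : Scheme.{u}) (t : T ⟶ D) (M : T.Modules) (r : (Scheme.Modules.pullback t).obj F ⟶ M),
      IsInvertible M → Epi r →
      ∃! v : T ⟶ P, ∃ (hv : v ≫ p = t) (e : (Scheme.Modules.pullback v).obj L ≅ M),
        (Scheme.Modules.pullbackCongr hv).inv.app F ≫
          (Scheme.Modules.pullbackComp v p).inv.app F ≫
          (Scheme.Modules.pullback v).map q ≫ e.hom = r

/-! ### Double point cobordisms -/

/-- `i : A ⟶ V` (a closed immersion) has codimension one: the local ring of `V` at the generic
point of each irreducible component of `A` has dimension one. -/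
def HasCodimOne {A V : Scheme.{u}} (i : A ⟶ V) : Prop :=
  ∀ x : A, closure {x} ∈ irreducibleComponents A → ringKrullDim (V.presheaf.stalk (i x)) = 1

/-- The morphism `f : V ⟶ Z` is smooth at the point `v`. -/
def SmoothAt {V Z : Scheme.{u}} (f : V ⟶ Z) (v : V) : Prop :=
  ∃ U : V.Opens, v ∈ U ∧ Smooth (U.ι ≫ f)

/-- The geometric data entering a double point relation over `X`, without the smoothness
conditions: a projective morphism `g : V ⟶ X × ℙ¹` such that, for `π = p₂ ∘ g`,
`π⁻¹(0) = A ∪ B` with `A`, `B` closed of codimension one in `V` whose intersection `D` has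
codimension one in `A` and in `B`; the projective bundle `P : ℙ(π) ⟶ D`; and a rational
point `ξ` of `ℙ¹`. -/
structure DoublePointData {k : Type u} [Field k] (X : Sch k) : Type (u + 1) where
  V : Sch k
  quasiProjective : IsQuasiProjective V
  g : V ⟶ prod X (projectiveSpace k 1)
  projective : IsProjective g
  A : Sch k
  B : Sch k
  a : A ⟶ V
  b : B ⟶ V
  isClosedImmersion_a : IsClosedImmersion a.left
  isClosedImmersion_b : IsClosedImmersion b.left
  /-- The ideal sheaf of the scheme-theoretic fibre `π⁻¹(0)` is the intersection of the ideal
  sheaves of `A` and `B`. -/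
  fiber_zero : (pullback.fst (g ≫ prodSnd X (projectiveSpace k 1)).left (zeroPoint k).left).ker =
    a.left.ker ⊓ b.left.ker
  codim_a : HasCodimOne a.left
  codim_b : HasCodimOne b.left
  codim_inter_left : HasCodimOne (pullback.fst a.left b.left)
  codim_inter_right : HasCodimOne (pullback.snd a.left b.left)
  /-- The projective bundle `ℙ(π)`. -/
  Pb : Sch k
  p : Pb.left ⟶ pullback a.left b.left
  p_comp : p ≫ pullback.fst a.left b.left ≫ A.hom = Pb.hom
  /-- `ℙ(π) = ℙ(𝒪_D ⊕ N_{A/D})`, the bundle of lines in `𝒪_D ⊕ N_{A/D}`, that is, `Proj` of the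
  symmetric algebra of the dual `𝒪_D ⊕ N_{A/D}^∨`. -/
  isProjectiveBundle : IsProjectiveBundle p
    (structureSheaf _ ⊞ conormalSheaf (pullback.fst a.left b.left))
  ξ : pt k ⟶ projectiveSpace k 1

namespace DoublePointData

/-- The morphism `p₁ ∘ g : V ⟶ X`. -/
def toX {k : Type u} [Field k] {X : Sch k} (T : DoublePointData X) : T.V ⟶ X :=
  T.g ≫ prodFst X (projectiveSpace k 1)

/-- The morphism `π = p₂ ∘ g : V ⟶ ℙ¹`. -/
def π {k : Type u} [Field k] {X : Sch k} (T : DoublePointData X) : T.V ⟶ projectiveSpace k 1 :=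
  T.g ≫ prodSnd X (projectiveSpace k 1)

/-- The double point locus `D = A ∩ B`. -/
def D {k : Type u} [Field k] {X : Sch k} (T : DoublePointData X) : Sch k :=
  Over.mk (pullback.fst T.a.left T.b.left ≫ T.A.hom)

/-- The inclusion `D ⟶ A`. -/
def dToA {k : Type u} [Field k] {X : Sch k} (T : DoublePointData X) : T.D ⟶ T.A :=
  Over.homMk (pullback.fst T.a.left T.b.left) rfl

/-- The projection `P : ℙ(π) ⟶ D`. -/
def pToD {k : Type u} [Field k] {X : Sch k} (T : DoublePointData X) : T.Pb ⟶ T.D :=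
  Over.homMk T.p T.p_comp

/-- The fibre `V_ξ` of `π` over `ξ`. -/
def Vξ {k : Type u} [Field k] {X : Sch k} (T : DoublePointData X) : Sch k :=
  Over.mk (pullback.fst T.π.left T.ξ.left ≫ T.V.hom)

/-- The inclusion `V_ξ ⟶ V`. -/
def ξToV {k : Type u} [Field k] {X : Sch k} (T : DoublePointData X) : T.Vξ ⟶ T.V :=
  Over.homMk (pullback.fst T.π.left T.ξ.left) rfl

/-- The data form a double point cobordism over `X`: `V` is smooth, `A` and `B` are smooth and
intersect transversely (in the smooth scheme `D`, of codimension one in `A` and `B`), and `ξ`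
is a regular value of `π`. -/
structure IsDoublePointCobordism {k : Type u} [Field k] {X : Sch k} (T : DoublePointData X) :
    Prop where
  smooth_V : Smooth T.V.hom
  smooth_A : Smooth T.A.hom
  smooth_B : Smooth T.B.hom
  smooth_D : Smooth T.D.hom
  regular : ∀ v ∈ Set.range T.ξToV.left, SmoothAt T.π.left v

/-- The data form a double point cobordism relative to `f : X ⟶ Y`: `[p₁ g : V ⟶ X]` belongs to
`𝕄(𝒱/X ⟶ Y)`, the morphisms from `A`, `B`, `V_ξ` and `ℙ(π)` to `Y` are smooth, `A` and `B`
intersect transversely relative to `Y`, and `ξ` is a regular value of `π` relative to `Y`,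
i.e. `V ⟶ Y × ℙ¹` is smooth along `V_ξ`. If `Y` is a point, this is smoothness of `π`. -/
structure IsRelDoublePointCobordism {k : Type u} [Field k] {X Y : Sch k} (f : X ⟶ Y)
    (T : DoublePointData X) : Prop where
  cycle_V : IsBivariantCycle f T.V T.toX
  smooth_A : Smooth (T.a ≫ T.toX ≫ f).left
  smooth_B : Smooth (T.b ≫ T.toX ≫ f).left
  smooth_D : Smooth (T.dToA ≫ T.a ≫ T.toX ≫ f).left
  smooth_ξ : Smooth (T.ξToV ≫ T.toX ≫ f).left
  smooth_P : Smooth (T.pToD ≫ T.dToA ≫ T.a ≫ T.toX ≫ f).left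
  regular : ∀ v ∈ Set.range T.ξToV.left, SmoothAt (prodLift (T.toX ≫ f) T.π).left v

/-- `r` is the associated element `[V_ξ ⟶ X] - [A ⟶ X] - [B ⟶ X] + [ℙ(π) ⟶ X]`. -/
def IsRelation {k : Type u} [Field k] {X : Sch k} (P : CycleCondition X) (T : DoublePointData X)
    (r : CycleGroup P) : Prop :=
  ∃ (hξ : P T.Vξ (T.ξToV ≫ T.toX)) (hA : P T.A (T.a ≫ T.toX)) (hB : P T.B (T.b ≫ T.toX))
    (hP : P T.Pb (T.pToD ≫ T.dToA ≫ T.a ≫ T.toX)),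
    r = CycleGroup.cls ⟨_, _, hξ⟩ - CycleGroup.cls ⟨_, _, hA⟩ - CycleGroup.cls ⟨_, _, hB⟩ +
      CycleGroup.cls ⟨_, _, hP⟩

end DoublePointData

/-! ### Double point bordism -/

/-- The cycle group `𝓜_*(X)`. -/
abbrev M {k : Type u} [Field k] (X : Sch k) : Type (u + 1) :=
  CycleGroup (IsSmoothProjectiveCycle X)

/-- The subgroup `𝓡_*(X)` generated by the double point relations over `X`. -/
def R {k : Type u} [Field k] (X : Sch k) : AddSubgroup (M X) :=
  AddSubgroup.closure {r | ∃ T : DoublePointData X, T.IsDoublePointCobordism ∧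
    T.IsRelation (IsSmoothProjectiveCycle X) r}

/-- The double point bordism group `ω_*(X)`. -/
abbrev Omega {k : Type u} [Field k] (X : Sch k) : Type (u + 1) := M X ⧸ R X

/-- The class of `[h : W ⟶ X]` in `ω_*(X)`. -/
def Omega.cls {k : Type u} [Field k] {X : Sch k} (c : Cycle (IsSmoothProjectiveCycle X)) :
    Omega X :=
  QuotientAddGroup.mk (CycleGroup.cls c)

/-- The degree `n` part `ω_n(X)`. -/
def Omega.degree {k : Type u} [Field k] (X : Sch k) (n : ℕ) : AddSubgroup (Omega X) :=
  (CycleGroup.degree (IsSmoothProjectiveCycle X) n).map (QuotientAddGroup.mk' (R X))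

/-- The pre-motivic bivariant group `𝕄(𝒱/X ⟶ Y)`. -/
abbrev BivM {k : Type u} [Field k] {X Y : Sch k} (f : X ⟶ Y) : Type (u + 1) :=
  CycleGroup (IsBivariantCycle f)

/-- The subgroup `𝓡_*(X ⟶ Y)` generated by the double point relations relative to `f`. -/
def BivR {k : Type u} [Field k] {X Y : Sch k} (f : X ⟶ Y) : AddSubgroup (BivM f) :=
  AddSubgroup.closure {r | ∃ T : DoublePointData X, T.IsRelDoublePointCobordism f ∧
    T.IsRelation (IsBivariantCycle f) r}

/-- The bivariant group `𝕆𝔹3(X ⟶ Y)`. -/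
abbrev OB3 {k : Type u} [Field k] {X Y : Sch k} (f : X ⟶ Y) : Type (u + 1) := BivM f ⧸ BivR f

/-- The class of `[h : W ⟶ X]` in `𝕆𝔹3(X ⟶ Y)`. -/
def OB3.cls {k : Type u} [Field k] {X Y : Sch k} {f : X ⟶ Y} (c : Cycle (IsBivariantCycle f)) :
    OB3 f :=
  QuotientAddGroup.mk (CycleGroup.cls c)

/-- The degree `n` part of `𝕆𝔹3(X ⟶ Y)`. -/
def OB3.degree {k : Type u} [Field k] {X Y : Sch k} (f : X ⟶ Y) (n : ℕ) :
    AddSubgroup (OB3 f) :=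
  (CycleGroup.degree (IsBivariantCycle f) n).map (QuotientAddGroup.mk' (BivR f))

end

end DoublePoint

namespace DoublePoint

variable {k : Type u} [Field k]

section ProjectiveSpace

attribute [local instance] MvPolynomial.gradedAlgebra

/-! Over a point the two presentations have the same generators and the same relations, so the
isomorphism is the identity. Generators: `h ≫ toPt X` is the structure morphism of `W`, so the
smoothness conditions agree. Projective morphisms are proper because `ℙⁿ` is proper over `k`.
Conversely, if `W` is quasi-projective and `h` proper, an immersion `i` of `W` into `ℙⁿ` makes `(h,
i)` a closed immersion into `X × ℙⁿ` (`IsQuasiProjective.isProjective`). Together these give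
`isBivariantCycle_toPt`. Relations: since `pt × ℙ¹ ≅ ℙ¹`, relative regularity of `ξ` is ordinary
regularity. The extra smoothness demanded of `V_ξ` and `ℙ(π)` in the relative case holds as soon as
their classes are generators, as any relation requires (`isRelDoublePointCobordism_toPt_iff`). -/

lemma isProper_projectiveSpace_hom (k : Type u) [Field k] (n : ℕ) :
    IsProper (projectiveSpace k n).hom := by
  let 𝒜 := MvPolynomial.homogeneousSubmodule (Fin (n + 1)) k
  have : IsScalarTower k (𝒜 0) (MvPolynomial (Fin (n + 1)) k) :=
    IsScalarTower.of_algebraMap_eq (R := k) (S := 𝒜 0) (A := MvPolynomial (Fin (n + 1)) k)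
      fun _ => rfl
  have : Algebra.FiniteType (𝒜 0) (MvPolynomial (Fin (n + 1)) k) :=
    Algebra.FiniteType.of_restrictScalars_finiteType k _ _
  -- Homogeneous polynomials of degree `0` are constants, so `Spec (𝒜 0) ⟶ Spec k` is a closed
  -- immersion; `Proj` is proper over `Spec (𝒜 0)` by finite generation.
  have hs : Function.Surjective (algebraMap k (𝒜 0)) := by
    rintro ⟨x, hx⟩
    have hx' : x ∈ (1 : Submodule k (MvPolynomial (Fin (n + 1)) k)) := by
      rwa [← MvPolynomial.homogeneousSubmodule_zero]
    obtain ⟨y, hy⟩ := Submodule.mem_one.1 hx'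
    exact ⟨y, Subtype.ext hy⟩
  have : IsClosedImmersion (Spec.map (CommRingCat.ofHom (algebraMap k (𝒜 0)))) :=
    IsClosedImmersion.spec_of_surjective _ hs
  exact inferInstanceAs (IsProper (Proj.toSpecZero 𝒜 ≫
    Spec.map (CommRingCat.ofHom (algebraMap k (𝒜 0)))))

end ProjectiveSpace

lemma isProper_prodFst_projectiveSpace (X : Sch k) (n : ℕ) :
    IsProper (prodFst X (projectiveSpace k n)).left := by
  have := isProper_projectiveSpace_hom k n
  exact inferInstanceAs (IsProper (pullback.fst X.hom (projectiveSpace k n).hom))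

lemma IsProjective.isProper {V X : Sch k} {h : V ⟶ X} (H : IsProjective h) :
    IsProper h.left := by
  obtain ⟨n, i, hi, rfl⟩ := H
  have := isProper_prodFst_projectiveSpace X n
  rw [Over.comp_left]
  infer_instance

lemma prodLift_prodFst {V X Y : Sch k} (f : V ⟶ X) (g : V ⟶ Y) :
    prodLift f g ≫ prodFst X Y = f :=
  Over.OverMorphism.ext (pullback.lift_fst _ _ _)

lemma prodLift_prodSnd {V X Y : Sch k} (f : V ⟶ X) (g : V ⟶ Y) :
    prodLift f g ≫ prodSnd X Y = g :=
  Over.OverMorphism.ext (pullback.lift_snd _ _ _)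

/-- A proper morphism from a quasi-projective scheme is projective. -/
lemma IsQuasiProjective.isProjective {W X : Sch k} (hW : IsQuasiProjective W) {h : W ⟶ X}
    (hh : IsProper h.left) : IsProjective h := by
  obtain ⟨n, i, hi⟩ := hW
  refine ⟨n, prodLift h i, ?_, prodLift_prodFst h i⟩
  have h₁ : (prodLift h i).left ≫ (prodFst X (projectiveSpace k n)).left = h.left := by
    rw [← Over.comp_left, prodLift_prodFst]
  have h₂ : (prodLift h i).left ≫ (prodSnd X (projectiveSpace k n)).left = i.left := by
    rw [← Over.comp_left, prodLift_prodSnd]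
  -- Cancellation on both projections: `(h, i)` is proper because its first component is, and an
  -- immersion because its second is. An immersion with closed image is a closed immersion.
  have := isProper_prodFst_projectiveSpace X n
  have : IsProper ((prodLift h i).left ≫ (prodFst X (projectiveSpace k n)).left) := by rwa [h₁]
  have : IsProper (prodLift h i).left :=
    IsProper.of_comp _ (prodFst X (projectiveSpace k n)).left
  have : IsImmersion ((prodLift h i).left ≫ (prodSnd X (projectiveSpace k n)).left) := by
    rwa [h₂]
  have : IsImmersion (prodLift h i).left :=
    IsImmersion.of_comp _ (prodSnd X (projectiveSpace k n)).left
  exact .of_isPreimmersion _ (prodLift h i).left.isClosedMap.isClosed_range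

lemma comp_toPt_left {W X : Sch k} (h : W ⟶ X) : (h ≫ toPt X).left = W.hom := Over.w h

/-- Over a point, the bivariant cycles are the smooth projective cycles. -/
lemma isBivariantCycle_toPt (X : Sch k) :
    IsBivariantCycle (toPt X) = IsSmoothProjectiveCycle X := by
  funext W h
  simp only [IsBivariantCycle, IsSmoothProjectiveCycle, comp_toPt_left]
  exact propext ⟨fun ⟨hW, hh, hs⟩ => ⟨hW, hs, hW.isProjective hh⟩,
    fun ⟨hW, hs, hh⟩ => ⟨hW, hh.isProper, hs⟩⟩

lemma isIso_prodSnd_pt (Y : Sch k) : IsIso (prodSnd (pt k) Y).left :=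
  inferInstanceAs (IsIso (pullback.snd (𝟙 _) Y.hom))

lemma SmoothAt.comp_isIso {V Z Z' : Scheme.{u}} {f : V ⟶ Z} {v : V} (h : SmoothAt f v)
    (e : Z ⟶ Z') [IsIso e] : SmoothAt (f ≫ e) v := by
  obtain ⟨U, hv, hU⟩ := h
  exact ⟨U, hv, (Category.assoc U.ι f e) ▸ inferInstance⟩

lemma smoothAt_comp_isIso_iff {V Z Z' : Scheme.{u}} (f : V ⟶ Z) (e : Z ⟶ Z') [IsIso e] (v : V) :
    SmoothAt (f ≫ e) v ↔ SmoothAt f v :=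
  ⟨fun h => by simpa using h.comp_isIso (inv e), fun h => h.comp_isIso e⟩

/-- The projection `pt × Y ⟶ Y` is an isomorphism. With `Y = ℙ¹` and `g = π`, this turns regularity
relative to `pt` into absolute regularity. -/
lemma smoothAt_prodLift_pt_iff {V Y : Sch k} (f : V ⟶ pt k) (g : V ⟶ Y) (v : V.left) :
    SmoothAt (prodLift f g).left v ↔ SmoothAt g.left v := by
  have := isIso_prodSnd_pt Y
  rw [← smoothAt_comp_isIso_iff _ (prodSnd (pt k) Y).left, ← Over.comp_left, prodLift_prodSnd]

namespace DoublePointData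

variable {X : Sch k}

lemma isProper_toX (T : DoublePointData X) : IsProper T.toX.left := by
  have := T.projective.isProper
  have := isProper_prodFst_projectiveSpace X 1
  rw [toX, Over.comp_left]
  infer_instance

/-- Over a point, the relative double point cobordisms which define a relation are the double
point cobordisms which do. -/
lemma isRelDoublePointCobordism_toPt_iff {T : DoublePointData X}
    {r : CycleGroup (IsSmoothProjectiveCycle X)}
    (hr : T.IsRelation (IsSmoothProjectiveCycle X) r) :
    T.IsRelDoublePointCobordism (toPt X) ↔ T.IsDoublePointCobordism := by
  -- Smoothness of `V_ξ` and `ℙ(π)` is not part of `IsDoublePointCobordism`; it is read off from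
  -- their being cycles in the relation `r`.
  obtain ⟨hξ, -, -, hP, -⟩ := hr
  constructor
  · intro H
    have hA := H.smooth_A
    have hB := H.smooth_B
    have hD := H.smooth_D
    simp only [← Category.assoc, comp_toPt_left] at hA hB hD
    exact
      { smooth_V := comp_toPt_left T.toX ▸ H.cycle_V.2.2
        smooth_A := hA
        smooth_B := hB
        smooth_D := hD
        regular := fun v hv => (smoothAt_prodLift_pt_iff _ _ v).1 (H.regular v hv) }
  · intro H
    refine ⟨⟨T.quasiProjective, T.isProper_toX, ?_⟩, ?_, ?_, ?_, ?_, ?_,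
      fun v hv => (smoothAt_prodLift_pt_iff _ _ v).2 (H.regular v hv)⟩
    all_goals simp only [← Category.assoc, comp_toPt_left]
    exacts [H.smooth_V, H.smooth_A, H.smooth_B, H.smooth_D, hξ.2.1, hP.2.1]

end DoublePointData

end DoublePoint

theorem mainTheorem3 {k : Type u} [Field k] [CharZero k] (X : DoublePoint.Sch k)
    (hX : DoublePoint.IsQuasiProjective X) :
    ∃ e : DoublePoint.OB3 (DoublePoint.toPt X) ≃+ DoublePoint.Omega X,
      (∀ c : DoublePoint.Cycle (DoublePoint.IsBivariantCycle (DoublePoint.toPt X)),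
        ∃ hc : DoublePoint.IsSmoothProjectiveCycle X c.W c.h,
          e (DoublePoint.OB3.cls c) = DoublePoint.Omega.cls ⟨c.W, c.h, hc⟩) ∧
      ∀ n : ℕ, (DoublePoint.OB3.degree (DoublePoint.toPt X) n).map (e : _ →+ _) =
        DoublePoint.Omega.degree X n := by
  -- The groups depend on the cycle condition as types. Making `P` and `S` variables lets both
  -- equalities be substituted, so that no transport remains and the identity serves as `e`.
  have key : ∀ (P : DoublePoint.CycleCondition X) (S : AddSubgroup (DoublePoint.CycleGroup P)),
      P = DoublePoint.IsSmoothProjectiveCycle X →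
      S = AddSubgroup.closure {r | ∃ T : DoublePoint.DoublePointData X,
        T.IsRelDoublePointCobordism (DoublePoint.toPt X) ∧ T.IsRelation P r} →
      ∃ e : DoublePoint.CycleGroup P ⧸ S ≃+ DoublePoint.Omega X,
        (∀ c : DoublePoint.Cycle P, ∃ hc : DoublePoint.IsSmoothProjectiveCycle X c.W c.h,
          e (QuotientAddGroup.mk (DoublePoint.CycleGroup.cls c)) =
            DoublePoint.Omega.cls ⟨c.W, c.h, hc⟩) ∧
        ∀ n : ℕ, ((DoublePoint.CycleGroup.degree P n).map (QuotientAddGroup.mk' S)).map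
          (e : _ →+ _) = DoublePoint.Omega.degree X n := by
    rintro P S rfl hS
    obtain rfl : S = DoublePoint.R X := by
      rw [hS, DoublePoint.R]
      congr 1
      ext r
      -- The two notions of cobordism need only agree on data that define a relation, so `hr` may be
      -- assumed.
      exact exists_congr fun T => and_congr_left fun hr =>
        DoublePoint.DoublePointData.isRelDoublePointCobordism_toPt_iff hr
    exact ⟨AddEquiv.refl _, fun c => ⟨c.prop, rfl⟩, fun n => AddSubgroup.map_id _⟩
  exact key _ _ (DoublePoint.isBivariantCycle_toPt X) rfl
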